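/- Let $\mathcal X$ be a Polish space, $\mu$ a Borel probability measure on $\mathcal X$, and $X_1,X_2,\dots$ i.i.d. $\mathcal X$-valued random variables with law $\mu$ on a probability space $(\Omega,\mathcal F,\mathbb P)$; write $L_n=\frac1n\sum_{k=1}^n\delta_{X_k}$. Let $c:\mathcal X\times\mathcal X\to[0,\infty]$ be lower semicontinuous, let $\alpha_1,\alpha_2:[0,\infty]\to[0,\infty]$ be convex, non-decreasing and continuous with $\alpha_1(0)=\alpha_2(0)=0$, and put $\alpha=\alpha_1\wedge\alpha_2$ (pointwise minimum). For Borel probability measures $\mu,\nu$ let $W_c(\mu,\nu)=\inf_\pi\iint c(x,y)\,d\pi(x,y)$, the infimum over all couplings $\pi$ with first marginal $\mu$ and second marginal $\nu$, and let $H(\nu\,|\,\mu)=\int\log\frac{d\nu}{d\mu}\,d\nu$ be the relative entropy. Say that $\mu\in\mathscr T_\alpha(c)$ if $\alpha(W_c(\mu,\nu))\le H(\nu\,|\,\mu)$ for all Borel probability measures $\nu\ll\mu$. Then the following are equivalent: (i) $\mu\in\mathscr T_\alpha(c)$; (ii) for all $f,g\in L^1(\mu)$ such that, for some $\mu$-null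 set $N$, $g(x)+f(y)\le c(x,y)$ for all $x,y\in\mathcal X\setminus N$, and for all integers $n\ge1$ and reals $r>0$, $$\frac1n\log\mathbb P\Big[\int f\,dL_n+\int g\,d\mu\ge r\Big]=\frac1n\log\mathbb P\Big[\frac1n\sum_{k=1}^n f(X_k)+\int g\,d\mu\ge r\Big]\le-\alpha(r)\qquad(\log 0=-\infty).$$ If moreover $c$ is continuous (as a map into $[0,\infty]$), then (i) is also equivalent to (ii) with the condition on $(f,g)$ replaced by: $g(x)+f(y)\le c(x,y)$ for $\mu\otimes\mu$-almost every $(x,y)$. (For symmetric $c$ the roles of $x$ and $y$ in these conditions can be exchanged.) -/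

import Mathlib

open MeasureTheory ProbabilityTheory
open scoped NNReal ENNReal

noncomputable section

/-- The couplings of `μ` and `ν`: measures on the product with first marginal `μ` and second
marginal `ν` (they are probability measures as soon as `μ` or `ν` is). -/
def couplings {𝓧 : Type*} [MeasurableSpace 𝓧] (μ ν : Measure 𝓧) : Set (Measure (𝓧 × 𝓧)) :=
  {π | π.fst = μ ∧ π.snd = ν}

/-- The transportation cost `W_c(μ, ν)`, the infimum of `∬ c dπ` over the couplings `π`. -/
def transportCost {𝓧 : Type*} [MeasurableSpace 𝓧] (c : 𝓧 × 𝓧 → ℝ≥0∞) (μ ν : Measure 𝓧) :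
    ℝ≥0∞ :=
  ⨅ π ∈ couplings μ ν, ∫⁻ p, c p ∂π

/-- The `(α, c)`-transportation-cost inequality: `α (W_c(μ, ν)) ≤ H(ν | μ)` for every probability
measure `ν ≪ μ`. The relative entropy `H(ν | μ)` is `InformationTheory.klDiv ν μ`. -/
def SatisfiesTCI {𝓧 : Type*} [MeasurableSpace 𝓧] (α : ℝ≥0∞ → ℝ≥0∞) (c : 𝓧 × 𝓧 → ℝ≥0∞)
    (μ : Measure 𝓧) : Prop :=
  ∀ ν : Measure 𝓧, IsProbabilityMeasure ν → ν ≪ μ →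
    α (transportCost c μ ν) ≤ InformationTheory.klDiv ν μ

/-- The `n`-sample empirical measure `(1/n) ∑_{k < n} δ_{x k}`. -/
def empiricalMeasure {𝓧 : Type*} [MeasurableSpace 𝓧] (n : ℕ) (x : ℕ → 𝓧) : Measure 𝓧 :=
  (n : ℝ≥0∞)⁻¹ • ∑ k ∈ Finset.range n, Measure.dirac (x k)

/-- The non-asymptotic deviation estimate for a pair `(f, g)`: for all `n ≥ 1` and all `r > 0`,
`(1/n) log ℙ[∫ f dL_n + ∫ g dμ ≥ r] = (1/n) log ℙ[(1/n) ∑ f(X_k) + ∫ g dμ ≥ r] ≤ -α(r)`.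
The logarithm is extended-real valued, with `log 0 = -∞`. -/
def DeviationEstimate {Ω 𝓧 : Type*} [MeasurableSpace Ω] [MeasurableSpace 𝓧]
    (P : Measure Ω) (X : ℕ → Ω → 𝓧) (μ : Measure 𝓧) (α : ℝ≥0∞ → ℝ≥0∞) (f g : 𝓧 → ℝ) : Prop :=
  ∀ n : ℕ, 0 < n → ∀ r : ℝ, 0 < r →
    ((1 / (n : ℝ) : ℝ) : EReal) * ENNReal.log
        (P {ω | r ≤ (∫ x, f x ∂(empiricalMeasure n fun k => X k ω)) + ∫ x, g x ∂μ}) =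
      ((1 / (n : ℝ) : ℝ) : EReal) * ENNReal.log
        (P {ω | r ≤ (1 / (n : ℝ)) * (∑ k ∈ Finset.range n, f (X k ω)) + ∫ x, g x ∂μ}) ∧
    ((1 / (n : ℝ) : ℝ) : EReal) * ENNReal.log
        (P {ω | r ≤ (1 / (n : ℝ)) * (∑ k ∈ Finset.range n, f (X k ω)) + ∫ x, g x ∂μ}) ≤
      -((α (ENNReal.ofReal r) : ℝ≥0∞) : EReal)

end

open Filter Topology Set InformationTheory

/-! From (i) to the deviation bounds: condition on the deviation event `A` and let `ν` be the
average of the conditional laws of the first `n` variables (`averagedCondLaw`). Jensen and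
independence give H(ν|μ) ≤ -(1/n) log P(A) (`klDiv_averagedCondLaw_le`), while ∫ f dν + ∫ g dμ ≥ r
because the mean is controlled on `A`. The easy half of duality turns this into W_c(μ,ν) ≥ r, so
α(r) ≤ α(W_c(μ,ν)) ≤ H(ν|μ) ≤ -(1/n) log P(A). This is exact for every `n`.

Conversely, if α(W_c(μ,ν)) > H(ν|μ), continuity of α gives t < W_c(μ,ν) with α(t) > H(ν|μ).
Kantorovich duality (`exists_coupling_lintegral_le`) supplies bounded f, g with g(x) + f(y) ≤ c(x,y)
and ∫ g dμ + ∫ f dν > t. Under i.i.d. sampling from ν the deviation at level t is typical, and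
changing measure back to μ costs about exp(-n H(ν|μ)) (`eventually_exp_le_infinitePi`). The assumed
estimate then forces α(t) ≤ H(ν|μ), a contradiction.

Duality is proved by a positive extension argument on the Stone–Čech compactification of the
product: the extended functional is a measure there, tightness of the marginals puts its mass on the
product itself, and the cost is approximated from below by bounded continuous functions. For
continuous c, an almost everywhere constraint already holds off a null set
(`exists_null_forall_le_of_ae_prod`). -/

/-! ### Measures on a compactification and their descent to the original space. -/

theorem exists_regular_measure_integral_eq {Z : Type*} [TopologicalSpace Z] [CompactSpace Z]
    [T2Space Z] [MeasurableSpace Z] [BorelSpace Z] (Λ : C(Z, ℝ) →ₗ[ℝ] ℝ)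
    (hΛ : ∀ F : C(Z, ℝ), 0 ≤ F → 0 ≤ Λ F) :
    ∃ m : Measure Z, m.Regular ∧ IsFiniteMeasure m ∧ ∀ F : C(Z, ℝ), ∫ z, F z ∂m = Λ F := by
  let Λ' : CompactlySupportedContinuousMap Z ℝ →ₚ[ℝ] ℝ :=
    { toFun F := Λ F.toContinuousMap
      map_add' F G := map_add Λ F.toContinuousMap G.toContinuousMap
      map_smul' a F := map_smul Λ a F.toContinuousMap
      monotone' F G hFG := by
        have h := hΛ (G.toContinuousMap - F.toContinuousMap) fun z ↦ sub_nonneg.2 (hFG z)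
        rw [map_sub] at h
        exact sub_nonneg.1 h }
  refine ⟨RealRMK.rieszMeasure Λ', inferInstance, inferInstance, fun F ↦ ?_⟩
  exact RealRMK.integral_rieszMeasure Λ'
    { toFun := F
      hasCompactSupport' := HasCompactSupport.of_compactSpace _ }

/-- The range of `e` need not be Borel in `Z`. Since a countable union of compact images has full
measure, the image of a Borel set is a Borel set up to a null set, which is what pulling `m` back
along `e` requires. -/
theorem exists_map_eq_of_isEmbedding {Y Z : Type*} [TopologicalSpace Y] [TopologicalSpace Z]
    [T2Space Z] [MeasurableSpace Y] [BorelSpace Y] [MeasurableSpace Z] [BorelSpace Z]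
    {e : Y → Z} (he : IsEmbedding e) (m : Measure Z) {C : ℕ → Set Y}
    (hC : ∀ n, IsCompact (C n)) (hm : m (⋃ n, e '' C n)ᶜ = 0) :
    ∃ π : Measure Y, π.map e = m := by
  have : T2Space Y := he.t2Space
  have hnull : m (range e)ᶜ = 0 :=
    measure_mono_null (compl_subset_compl.2 (iUnion_subset fun n ↦ image_subset_range _ _)) hm
  have hmeas (s : Set Y) (hs : MeasurableSet s) : NullMeasurableSet (e '' s) m := by
    have hn (n : ℕ) : MeasurableSet (e '' (C n ∩ s)) := by
      have : CompactSpace (C n) := isCompact_iff_compactSpace.1 (hC n)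
      have hemb : IsClosedEmbedding (e ∘ ((↑) : C n → Y)) :=
        (he.continuous.comp continuous_subtype_val).isClosedEmbedding
          (he.injective.comp Subtype.val_injective)
      rw [← Subtype.image_preimage_coe, ← image_comp]
      exact hemb.measurableEmbedding.measurableSet_image' (measurable_subtype_coe hs)
    have hsub : e '' (s \ ⋃ n, C n) ⊆ (⋃ n, e '' C n)ᶜ := by
      rintro _ ⟨y, hy, rfl⟩ h
      obtain ⟨n, y', hy', hyy'⟩ := mem_iUnion.1 h
      exact hy.2 (mem_iUnion.2 ⟨n, he.injective hyy' ▸ hy'⟩)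
    have heq : e '' s = (⋃ n, e '' (C n ∩ s)) ∪ e '' (s \ ⋃ n, C n) := by
      rw [← image_iUnion, ← image_union, ← iUnion_inter, inter_comm, inter_union_sdiff]
    rw [heq]
    exact (MeasurableSet.iUnion hn).nullMeasurableSet.union
      (NullMeasurableSet.of_null (measure_mono_null hsub hm))
  have hme : Measurable e := he.continuous.measurable
  refine ⟨m.comap e, ?_⟩
  ext A hA
  rw [Measure.map_apply hme hA,
    Measure.comap_apply₀ e m he.injective hmeas (hme hA).nullMeasurableSet,
    image_preimage_eq_inter_range]
  refine le_antisymm (measure_mono inter_subset_left) ?_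
  calc m A ≤ m (A ∩ range e) + m (range e)ᶜ :=
        (measure_mono fun z hz ↦ by by_cases h : z ∈ range e <;> simp_all).trans
          (measure_union_le _ _)
    _ = m (A ∩ range e) := by rw [hnull, add_zero]

/-! ### Approximation of lower semicontinuous costs from below. -/

section Approximation

variable {Y : Type*} [PseudoEMetricSpace Y]

/-- The Lipschitz regularization of `min c n`, of Lipschitz constant `n`. -/
noncomputable def lipschitzRegularization (c : Y → ℝ≥0∞) (n : ℕ) (x : Y) : ℝ≥0∞ :=
  ⨅ y, (min (c y) n + n * edist x y)

theorem lipschitzRegularization_le (c : Y → ℝ≥0∞) (n : ℕ) (x : Y) :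
    lipschitzRegularization c n x ≤ min (c x) n :=
  (iInf_le _ x).trans (by simp)

theorem monotone_lipschitzRegularization (c : Y → ℝ≥0∞) :
    Monotone (lipschitzRegularization c) := by
  intro n k hnk x
  unfold lipschitzRegularization
  gcongr

theorem continuous_lipschitzRegularization (c : Y → ℝ≥0∞) (n : ℕ) :
    Continuous (lipschitzRegularization c n) := by
  refine continuous_of_le_add_edist n (by simp) fun x y ↦ ?_
  unfold lipschitzRegularization
  rw [ENNReal.iInf_add]
  refine le_iInf fun z ↦ (iInf_le _ z).trans ?_
  rw [add_assoc, ← mul_add, add_comm (edist y z)]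
  gcongr
  exact edist_triangle x y z

/-- For s < c(x), lower semicontinuity keeps c above s on a ball of radius δ around x; outside the
ball the penalty alone exceeds s once the Lipschitz constant is at least s/δ. -/
theorem iSup_lipschitzRegularization {c : Y → ℝ≥0∞} (hc : LowerSemicontinuous c) (x : Y) :
    ⨆ n, lipschitzRegularization c n x = c x := by
  refine le_antisymm (iSup_le fun n ↦
    (lipschitzRegularization_le c n x).trans (min_le_left _ _)) ?_
  refine le_of_forall_lt fun t ht ↦ ?_
  obtain ⟨s, hts, hsc⟩ := exists_between ht
  obtain ⟨δ, hδ, hball⟩ := EMetric.mem_nhds_iff.1 (hc x s hsc)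
  have hs : s ≠ ⊤ := hsc.ne_top
  wlog hδt : δ ≠ ⊤ generalizing δ
  · exact this 1 (by simp)
      ((Metric.eball_subset_eball (by simp [not_ne_iff.1 hδt])).trans hball) (by simp)
  obtain ⟨n, hn⟩ := ENNReal.exists_nat_gt hs
  obtain ⟨k, hk⟩ := ENNReal.exists_nat_gt (ENNReal.div_lt_top hs hδ.ne').ne
  refine hts.trans_le (le_iSup_of_le (max n k) (le_iInf fun y ↦ ?_))
  have hnk : (n : ℝ≥0∞) ≤ (max n k : ℕ) := by exact_mod_cast le_max_left n k
  have hkk : (k : ℝ≥0∞) ≤ (max n k : ℕ) := by exact_mod_cast le_max_right n k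
  by_cases hy : edist y x < δ
  · exact (le_min (hball hy).le (hn.le.trans hnk)).trans le_self_add
  · rw [not_lt, edist_comm] at hy
    refine le_trans ?_ le_add_self
    calc s ≤ s / δ * δ := by
          rw [ENNReal.div_mul_cancel hδ.ne' hδt]
      _ ≤ (max n k : ℕ) * edist x y := by gcongr; exact hk.le.trans hkk

end Approximation

/-! ### Kantorovich duality. -/

/-- Bounded measurable real functions. -/
def BoundedMeasurable {S : Type*} [MeasurableSpace S] (f : S → ℝ) : Prop :=
  Measurable f ∧ ∃ C : ℝ, ∀ x, |f x| ≤ C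

namespace BoundedMeasurable

variable {S : Type*} [MeasurableSpace S] {f g : S → ℝ}

theorem add (hf : BoundedMeasurable f) (hg : BoundedMeasurable g) :
    BoundedMeasurable fun x ↦ f x + g x := by
  obtain ⟨hf, C, hC⟩ := hf
  obtain ⟨hg, B, hB⟩ := hg
  exact ⟨hf.add hg, C + B, fun x ↦ (abs_add_le _ _).trans (add_le_add (hC x) (hB x))⟩

theorem const_mul (hf : BoundedMeasurable f) (a : ℝ) : BoundedMeasurable fun x ↦ a * f x := by
  obtain ⟨hf, C, hC⟩ := hf
  refine ⟨hf.const_mul a, |a| * C, fun x ↦ ?_⟩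
  rw [abs_mul]
  gcongr
  exact hC x

theorem const (a : ℝ) : BoundedMeasurable fun _ : S ↦ a :=
  ⟨measurable_const, |a|, fun _ ↦ le_rfl⟩

theorem integrable (hf : BoundedMeasurable f) (μ : Measure S) [IsFiniteMeasure μ] :
    Integrable f μ := by
  obtain ⟨hf, C, hC⟩ := hf
  exact .of_bound hf.aestronglyMeasurable C (ae_of_all _ hC)

theorem indicator_one {A : Set S} (hA : MeasurableSet A) :
    BoundedMeasurable (A.indicator (1 : S → ℝ)) := by
  refine ⟨measurable_one.indicator hA, 1, fun x ↦ ?_⟩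
  by_cases hx : x ∈ A <;> simp [hx]

theorem of_boundedContinuous [TopologicalSpace S] [OpensMeasurableSpace S]
    (f : BoundedContinuousFunction S ℝ) : BoundedMeasurable f :=
  ⟨f.continuous.measurable, ‖f‖, f.norm_coe_le_norm⟩

end BoundedMeasurable

section Duality

variable {𝓧 𝓨 Z : Type*} [MeasurableSpace 𝓧] [MeasurableSpace 𝓨] [TopologicalSpace Z]

/-- The convex cone of pairs `(F, t)` such that `F ∘ e ≤ φ ⊕ ψ + l c` for bounded measurable `φ`,
`ψ` and `l ≥ 0` with `∫ φ dμ + ∫ ψ dν + l D ≤ t`. -/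
def majorantCone (e : 𝓧 × 𝓨 → Z) (c : 𝓧 × 𝓨 → ℝ≥0∞) (μ : Measure 𝓧) (ν : Measure 𝓨)
    [IsProbabilityMeasure μ] [IsProbabilityMeasure ν] (D : ℝ) : PointedCone ℝ (C(Z, ℝ) × ℝ) where
  carrier := {p | ∃ (φ : 𝓧 → ℝ) (ψ : 𝓨 → ℝ) (l : ℝ≥0), BoundedMeasurable φ ∧ BoundedMeasurable ψ ∧
    (∀ x y, ENNReal.ofReal (p.1 (e (x, y)) - φ x - ψ y) ≤ l * c (x, y)) ∧
    ∫ x, φ x ∂μ + ∫ y, ψ y ∂ν + l * D ≤ p.2}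
  zero_mem' := ⟨fun _ ↦ 0, fun _ ↦ 0, 0, .const 0, .const 0, by simp, by simp⟩
  add_mem' := by
    rintro ⟨F, s⟩ ⟨G, t⟩ ⟨φ, ψ, l, hφ, hψ, h, hs⟩ ⟨φ', ψ', l', hφ', hψ', h', ht⟩
    refine ⟨fun x ↦ φ x + φ' x, fun y ↦ ψ y + ψ' y, l + l', hφ.add hφ', hψ.add hψ',
      fun x y ↦ ?_, ?_⟩
    · rw [ENNReal.coe_add, add_mul]
      refine le_trans ?_ (add_le_add (h x y) (h' x y))
      refine le_trans (ENNReal.ofReal_le_ofReal (le_of_eq ?_)) ENNReal.ofReal_add_le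
      simp only [Prod.mk_add_mk, ContinuousMap.add_apply]
      ring
    · rw [integral_add (hφ.integrable μ) (hφ'.integrable μ),
        integral_add (hψ.integrable ν) (hψ'.integrable ν)]
      push_cast
      simp only [Prod.mk_add_mk] at hs ht ⊢
      linarith
  smul_mem' := by
    rintro ⟨a, ha⟩ ⟨F, s⟩ ⟨φ, ψ, l, hφ, hψ, h, hs⟩
    refine ⟨fun x ↦ a * φ x, fun y ↦ a * ψ y, a.toNNReal * l, hφ.const_mul a, hψ.const_mul a,
      fun x y ↦ ?_, ?_⟩
    · have h1 : ENNReal.ofReal (a * (F (e (x, y)) - φ x - ψ y)) ≤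
          ENNReal.ofReal a * (l * c (x, y)) := by
        rw [ENNReal.ofReal_mul ha]
        gcongr
        exact h x y
      rw [ENNReal.coe_mul, mul_assoc]
      refine le_trans (ENNReal.ofReal_le_ofReal (le_of_eq ?_)) h1
      change a * F (e (x, y)) - a * φ x - a * ψ y = _
      ring
    · rw [integral_const_mul, integral_const_mul]
      change _ ≤ a * s
      have h1 := mul_le_mul_of_nonneg_left hs ha
      rw [NNReal.coe_mul, Real.coe_toNNReal a ha]
      simp only at h1
      linarith

variable {e : 𝓧 × 𝓨 → Z} {c : 𝓧 × 𝓨 → ℝ≥0∞} {μ : Measure 𝓧} {ν : Measure 𝓨}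
  [IsProbabilityMeasure μ] [IsProbabilityMeasure ν] {D : ℝ}

theorem mem_majorantCone {p : C(Z, ℝ) × ℝ} : p ∈ majorantCone e c μ ν D ↔
    ∃ (φ : 𝓧 → ℝ) (ψ : 𝓨 → ℝ) (l : ℝ≥0), BoundedMeasurable φ ∧ BoundedMeasurable ψ ∧
    (∀ x y, ENNReal.ofReal (p.1 (e (x, y)) - φ x - ψ y) ≤ l * c (x, y)) ∧
    ∫ x, φ x ∂μ + ∫ y, ψ y ∂ν + l * D ≤ p.2 :=
  Iff.rfl

/-- If 0 ≤ φ ⊕ ψ + l c, then -φ/l and -ψ/l are admissible in the dual problem, so the bound `D`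
gives ∫ φ dμ + ∫ ψ dν + l D ≥ 0. This is the positivity needed to start the extension argument. -/
theorem nonneg_of_zero_mem_majorantCone
    (h : ∀ (f : 𝓧 → ℝ) (g : 𝓨 → ℝ), BoundedMeasurable f → BoundedMeasurable g →
      (∀ x y, ENNReal.ofReal (f x + g y) ≤ c (x, y)) → ∫ x, f x ∂μ + ∫ y, g y ∂ν ≤ D)
    {t : ℝ} (ht : ((0 : C(Z, ℝ)), t) ∈ majorantCone e c μ ν D) : 0 ≤ t := by
  have hD : 0 ≤ D := by
    simpa using h (fun _ ↦ 0) (fun _ ↦ 0) (.const 0) (.const 0) (by simp)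
  obtain ⟨φ, ψ, l, hφ, hψ, hle, hint⟩ := ht
  -- Dividing by l + ε instead of l covers l = 0; the error ε D vanishes in the limit.
  have key (ε : ℝ) (hε : 0 < ε) : -(ε * D) ≤ t := by
    have hlε : 0 < (l : ℝ) + ε := by positivity
    have h1 := h (fun x ↦ (-((l : ℝ) + ε)⁻¹) * φ x) (fun y ↦ (-((l : ℝ) + ε)⁻¹) * ψ y)
      (hφ.const_mul _) (hψ.const_mul _) fun x y ↦ by
        have h2 : -((l : ℝ) + ε)⁻¹ * φ x + -((l : ℝ) + ε)⁻¹ * ψ y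
            = ((l : ℝ) + ε)⁻¹ * (0 - φ x - ψ y) := by ring
        rw [h2, ENNReal.ofReal_mul (by positivity), ENNReal.ofReal_inv_of_pos hlε, mul_comm,
          ← div_eq_mul_inv]
        refine ENNReal.div_le_of_le_mul ((hle x y).trans ?_)
        rw [mul_comm]
        gcongr
        rw [← ENNReal.ofReal_coe_nnreal]
        exact ENNReal.ofReal_le_ofReal (by linarith)
    rw [integral_const_mul, integral_const_mul, ← mul_add, neg_mul, neg_le, ← div_eq_inv_mul,
      le_div_iff₀ hlε] at h1
    simp only at hint
    linarith
  have : Tendsto (fun ε : ℝ ↦ -(ε * D)) (𝓝[>] 0) (𝓝 (-(0 * D))) :=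
    ((tendsto_id.mono_left nhdsWithin_le_nhds).mul_const D).neg
  rw [zero_mul, neg_zero] at this
  exact le_of_tendsto this (eventually_mem_nhdsWithin.mono key)

/-- M. Riesz extension of the functional (0, t) ↦ t, positive on the cone by the previous lemma.
Every (F, t) can be moved into the cone by some (0, s), because F is at most the constant ‖F‖. If G
is the extension, Λ F = -G(F, 0). -/
theorem exists_linearMap_le_of_mem_majorantCone [CompactSpace Z]
    (h : ∀ (f : 𝓧 → ℝ) (g : 𝓨 → ℝ), BoundedMeasurable f → BoundedMeasurable g →
      (∀ x y, ENNReal.ofReal (f x + g y) ≤ c (x, y)) → ∫ x, f x ∂μ + ∫ y, g y ∂ν ≤ D) :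
    ∃ Λ : C(Z, ℝ) →ₗ[ℝ] ℝ, ∀ F t, (F, t) ∈ majorantCone e c μ ν D → Λ F ≤ t := by
  let f : (C(Z, ℝ) × ℝ) →ₗ.[ℝ] ℝ :=
    { domain := Submodule.prod ⊥ ⊤
      toFun := (LinearMap.snd ℝ C(Z, ℝ) ℝ).comp (Submodule.subtype _) }
  obtain ⟨G, hG, hGnonneg⟩ := riesz_extension (majorantCone e c μ ν D) f
    (by
      rintro ⟨⟨F, t⟩, hF⟩ hmem
      have hF0 : F = 0 := (Submodule.mem_prod.1 hF).1
      subst hF0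
      exact nonneg_of_zero_mem_majorantCone h hmem)
    (by
      rintro ⟨F, t⟩
      refine ⟨⟨(0, ‖F‖ - t), by simp [f]⟩, fun _ ↦ ‖F‖, fun _ ↦ 0, 0, .const _, .const _,
        fun x y ↦ ?_, by simp⟩
      simpa using (le_abs_self _).trans (F.norm_coe_le_norm (e (x, y))))
  refine ⟨-(G.comp (LinearMap.inl ℝ _ _)), fun F t hFt ↦ ?_⟩
  have h1 := hGnonneg _ hFt
  have h2 : G (0, t) = t := hG ⟨(0, t), by simp [f]⟩
  have h3 : ((F, t) : C(Z, ℝ) × ℝ) = (F, 0) + (0, t) := by simp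
  rw [h3, map_add, h2] at h1
  simp only [LinearMap.neg_apply, LinearMap.comp_apply, LinearMap.inl_apply]
  linarith

end Duality

theorem exists_continuousMap_stoneCech_extension {Y : Type*} [TopologicalSpace Y]
    (u : BoundedContinuousFunction Y ℝ) :
    ∃ F : C(StoneCech Y, ℝ), ∀ y, F (stoneCechUnit y) = u y := by
  let u' : Y → Icc (-‖u‖) ‖u‖ := fun y ↦ ⟨u y, abs_le.1 (u.norm_coe_le_norm y)⟩
  have hu' : Continuous u' := u.continuous.subtype_mk _
  refine ⟨⟨fun z ↦ (stoneCechExtend hu' z : Icc (-‖u‖) ‖u‖),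
    continuous_subtype_val.comp (continuous_stoneCechExtend hu')⟩, fun y ↦ ?_⟩
  exact congrArg Subtype.val (congrFun (stoneCechExtend_extends hu') y)

/-- A compact set carrying all but `ε` of the mass. -/
theorem exists_isCompact_measure_compl_le {S : Type*} [TopologicalSpace S] [PolishSpace S]
    [MeasurableSpace S] [BorelSpace S] (μ : Measure S) [IsFiniteMeasure μ] {ε : ℝ} (hε : 0 < ε) :
    ∃ K : Set S, IsCompact K ∧ μ.real Kᶜ ≤ ε := by
  obtain ⟨K, hK, h⟩ := isTightMeasureSet_iff_exists_isCompact_measure_compl_le.1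
    (isTightMeasureSet_singleton (μ := μ)) (ENNReal.ofReal ε) (by simpa using hε)
  exact ⟨K, hK, ENNReal.toReal_le_of_le_ofReal hε.le (h μ rfl)⟩

/-- **Kantorovich duality** for lower semicontinuous costs: if `D` bounds the dual problem, then
some coupling has cost at most `D`. -/
theorem exists_coupling_lintegral_le {𝓧 𝓨 : Type*}
    [TopologicalSpace 𝓧] [PolishSpace 𝓧] [MeasurableSpace 𝓧] [BorelSpace 𝓧]
    [TopologicalSpace 𝓨] [PolishSpace 𝓨] [MeasurableSpace 𝓨] [BorelSpace 𝓨]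
    (μ : Measure 𝓧) [IsProbabilityMeasure μ] (ν : Measure 𝓨) [IsProbabilityMeasure ν]
    {c : 𝓧 × 𝓨 → ℝ≥0∞} (hc : LowerSemicontinuous c) {D : ℝ}
    (h : ∀ (f : 𝓧 → ℝ) (g : 𝓨 → ℝ), BoundedMeasurable f → BoundedMeasurable g →
      (∀ x y, ENNReal.ofReal (f x + g y) ≤ c (x, y)) → ∫ x, f x ∂μ + ∫ y, g y ∂ν ≤ D) :
    ∃ π : Measure (𝓧 × 𝓨), π.fst = μ ∧ π.snd = ν ∧ ∫⁻ p, c p ∂π ≤ ENNReal.ofReal D := by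
  let := TopologicalSpace.upgradeIsCompletelyMetrizable 𝓧
  let := TopologicalSpace.upgradeIsCompletelyMetrizable 𝓨
  let : MeasurableSpace (StoneCech (𝓧 × 𝓨)) := borel _
  have : BorelSpace (StoneCech (𝓧 × 𝓨)) := ⟨rfl⟩
  set e : 𝓧 × 𝓨 → StoneCech (𝓧 × 𝓨) := stoneCechUnit
  have he : IsEmbedding e := isEmbedding_stoneCechUnit
  obtain ⟨Λ, hΛ⟩ := exists_linearMap_le_of_mem_majorantCone (e := e) h
  have hΛpos (F : C(StoneCech (𝓧 × 𝓨), ℝ)) (hF : 0 ≤ F) : 0 ≤ Λ F := by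
    have := hΛ (-F) 0 (mem_majorantCone.2 ⟨fun _ ↦ 0, fun _ ↦ 0, 0, .const 0, .const 0,
      fun x y ↦ by simpa using hF (e (x, y)), by simp⟩)
    rw [map_neg] at this
    linarith
  obtain ⟨m, _, _, hm⟩ := exists_regular_measure_integral_eq Λ hΛpos
  -- Cone elements with l = 0 encode the marginal constraints; those with φ = ψ = 0 and l = 1 will
  -- encode the cost bound.
  have hmarg (F : C(StoneCech (𝓧 × 𝓨), ℝ)) (φ : 𝓧 → ℝ) (ψ : 𝓨 → ℝ) (hφ : BoundedMeasurable φ)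
      (hψ : BoundedMeasurable ψ) (hF : ∀ x y, F (e (x, y)) ≤ φ x + ψ y) :
      Λ F ≤ ∫ x, φ x ∂μ + ∫ y, ψ y ∂ν :=
    hΛ F _ (mem_majorantCone.2 ⟨φ, ψ, 0, hφ, hψ,
      fun x y ↦ by simpa [add_comm] using hF x y, by simp⟩)
  have hmarg' (F : C(StoneCech (𝓧 × 𝓨), ℝ)) (φ : 𝓧 → ℝ) (ψ : 𝓨 → ℝ) (hφ : BoundedMeasurable φ)
      (hψ : BoundedMeasurable ψ) (hF : ∀ x y, φ x + ψ y ≤ F (e (x, y))) :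
      ∫ x, φ x ∂μ + ∫ y, ψ y ∂ν ≤ Λ F := by
    have := hmarg (-F) (fun x ↦ (-1) * φ x) (fun y ↦ (-1) * ψ y) (hφ.const_mul _) (hψ.const_mul _)
      fun x y ↦ by simpa [add_comm] using neg_le_neg (hF x y)
    rw [map_neg, integral_const_mul, integral_const_mul] at this
    linarith
  have hm1 : m.real univ = 1 := by
    have h1 := hm 1
    simp only [ContinuousMap.one_apply, integral_const, smul_eq_mul, mul_one] at h1
    rw [h1]
    apply le_antisymm
    · simpa using hmarg 1 (fun _ ↦ 1) (fun _ ↦ 0) (.const 1) (.const 0) (by simp)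
    · simpa using hmarg' 1 (fun _ ↦ 1) (fun _ ↦ 0) (.const 1) (.const 0) (by simp)
  have htight (ε : ℝ) (hε : 0 < ε) : ∃ C : Set (𝓧 × 𝓨), IsCompact C ∧ m.real (e '' C)ᶜ ≤ ε := by
    obtain ⟨K, hK, hKε⟩ := exists_isCompact_measure_compl_le μ (half_pos hε)
    obtain ⟨K', hK', hKε'⟩ := exists_isCompact_measure_compl_le ν (half_pos hε)
    refine ⟨K ×ˢ K', hK.prod hK', ?_⟩
    have hcomp : IsCompact (e '' (K ×ˢ K')) := (hK.prod hK').image he.continuous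
    -- `Λ` only sees continuous functions, so the compact image is enclosed in an open `U` of nearly
    -- the same mass and separated from its complement by a Urysohn function `F`. On the product, F
    -- ∘ e ≥ 1 - 1_{Kᶜ}(x) - 1_{K'ᶜ}(y), whose marginal integrals sum to at least 1 - ε.
    have hmono : 1 - ε ≤ m.real (e '' (K ×ˢ K')) := by
      by_contra! hlt
      have hlt' : m (e '' (K ×ˢ K')) < ENNReal.ofReal (1 - ε) := by
        rwa [ENNReal.lt_ofReal_iff_toReal_lt (measure_ne_top _ _)]
      obtain ⟨U, hUsub, hUopen, hU⟩ := Set.exists_isOpen_lt_of_lt _ _ hlt'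
      obtain ⟨F, hF0, hF1, hF⟩ := exists_continuous_zero_one_of_isClosed hUopen.isClosed_compl
        hcomp.isClosed (disjoint_compl_left_iff_subset.2 hUsub)
      have hup : Λ F ≤ m.real U := by
        rw [← hm F, ← integral_indicator_one hUopen.measurableSet]
        refine integral_mono (F.continuous.integrable_of_hasCompactSupport
          (.of_compactSpace _)) ((integrable_const (1 : ℝ)).indicator hUopen.measurableSet)
          fun z ↦ ?_
        by_cases hz : z ∈ U
        · simpa [hz] using (hF z).2
        · simpa [hz] using (hF0 hz).le
      have hlow := hmarg' F (fun x ↦ 1 + (-1) * Kᶜ.indicator 1 x)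
        (fun y ↦ (-1) * K'ᶜ.indicator 1 y)
        ((BoundedMeasurable.const 1).add
          ((BoundedMeasurable.indicator_one hK.measurableSet.compl).const_mul _))
        ((BoundedMeasurable.indicator_one hK'.measurableSet.compl).const_mul _) (fun x y ↦ by
          have h0 := (hF (e (x, y))).1
          by_cases hx : x ∈ K <;> by_cases hy : y ∈ K'
          · have := hF1 (mem_image_of_mem e (mk_mem_prod hx hy))
            simp [hx, hy, this]
          all_goals simp [hx, hy]
          all_goals linarith)
      rw [integral_add (integrable_const _)
          (((BoundedMeasurable.indicator_one hK.measurableSet.compl).const_mul _).integrable μ),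
        integral_const_mul, integral_const_mul, integral_indicator_one hK.measurableSet.compl,
        integral_indicator_one hK'.measurableSet.compl] at hlow
      simp only [integral_const, probReal_univ, smul_eq_mul, one_mul] at hlow
      have hU' : m.real U < 1 - ε := by
        rwa [ENNReal.lt_ofReal_iff_toReal_lt (measure_ne_top _ _)] at hU
      linarith
    rw [measureReal_compl hcomp.measurableSet, hm1]
    linarith
  choose C hC hCε using fun n : ℕ ↦ htight (1 / ((n : ℝ) + 1)) (by positivity)
  have hmnull : m (⋃ n, e '' C n)ᶜ = 0 := by
    rw [← measureReal_eq_zero_iff]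
    refine le_antisymm (ge_of_tendsto' tendsto_one_div_add_atTop_nhds_zero_nat fun n ↦ ?_)
      measureReal_nonneg
    exact (measureReal_mono (compl_subset_compl.2 (subset_iUnion (fun n ↦ e '' C n) n))).trans
      (hCε n)
  obtain ⟨π, hπ⟩ := exists_map_eq_of_isEmbedding he m hC hmnull
  have hme : Measurable e := he.continuous.measurable
  have hπint (F : C(StoneCech (𝓧 × 𝓨), ℝ)) : ∫ p, F (e p) ∂π = Λ F := by
    rw [← hm F, ← hπ, integral_map hme.aemeasurable F.continuous.aestronglyMeasurable]
  have hπprob : IsProbabilityMeasure π := by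
    constructor
    have := congrArg (fun ρ : Measure _ ↦ ρ univ) hπ
    simp only [Measure.map_apply hme MeasurableSet.univ, preimage_univ] at this
    rw [this, ← ENNReal.toReal_eq_one_iff]
    exact hm1
  refine ⟨π, ?_, ?_, ?_⟩
  · refine ext_of_forall_integral_eq_of_IsFiniteMeasure fun u ↦ ?_
    obtain ⟨F, hF⟩ := exists_continuousMap_stoneCech_extension
      (u.compContinuous ⟨Prod.fst, continuous_fst (X := 𝓧) (Y := 𝓨)⟩)
    have hF' (x : 𝓧) (y : 𝓨) : F (e (x, y)) = u x := hF (x, y)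
    rw [Measure.fst, integral_map measurable_fst.aemeasurable u.continuous.aestronglyMeasurable]
    have h1 := hπint F
    simp only [hF, e, BoundedContinuousFunction.compContinuous_apply, ContinuousMap.coe_mk] at h1
    rw [h1]
    apply le_antisymm
    · simpa using hmarg F u (fun _ ↦ 0) (.of_boundedContinuous u) (.const 0) (by simp [hF'])
    · simpa using hmarg' F u (fun _ ↦ 0) (.of_boundedContinuous u) (.const 0) (by simp [hF'])
  · refine ext_of_forall_integral_eq_of_IsFiniteMeasure fun u ↦ ?_
    obtain ⟨F, hF⟩ := exists_continuousMap_stoneCech_extension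
      (u.compContinuous ⟨Prod.snd, continuous_snd (X := 𝓧) (Y := 𝓨)⟩)
    have hF' (x : 𝓧) (y : 𝓨) : F (e (x, y)) = u y := hF (x, y)
    rw [Measure.snd, integral_map measurable_snd.aemeasurable u.continuous.aestronglyMeasurable]
    have h1 := hπint F
    simp only [hF, e, BoundedContinuousFunction.compContinuous_apply, ContinuousMap.coe_mk] at h1
    rw [h1]
    apply le_antisymm
    · simpa using hmarg F (fun _ ↦ 0) u (.const 0) (.of_boundedContinuous u) (by simp [hF'])
    · simpa using hmarg' F (fun _ ↦ 0) u (.const 0) (.of_boundedContinuous u) (by simp [hF'])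
  · have hcont := continuous_lipschitzRegularization c
    have hsup (p : 𝓧 × 𝓨) : c p = ⨆ n, lipschitzRegularization c n p :=
      (iSup_lipschitzRegularization hc p).symm
    simp_rw [hsup]
    rw [lintegral_iSup (fun n ↦ (hcont n).measurable) (monotone_lipschitzRegularization c)]
    refine iSup_le fun n ↦ ?_
    have hbd (p : 𝓧 × 𝓨) : lipschitzRegularization c n p ≤ n :=
      (lipschitzRegularization_le c n p).trans (min_le_right _ _)
    have hfin (p : 𝓧 × 𝓨) : lipschitzRegularization c n p ≠ ⊤ :=
      ((hbd p).trans_lt (ENNReal.natCast_lt_top n)).ne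
    let u : BoundedContinuousFunction (𝓧 × 𝓨) ℝ := .ofNormedAddCommGroup
      (fun p ↦ (lipschitzRegularization c n p).toReal)
      (ENNReal.continuousOn_toReal.comp_continuous (hcont n) hfin) n fun p ↦ by
        rw [Real.norm_of_nonneg ENNReal.toReal_nonneg]
        simpa using ENNReal.toReal_mono (ENNReal.natCast_ne_top n) (hbd p)
    have hu (p : 𝓧 × 𝓨) : u p = (lipschitzRegularization c n p).toReal := rfl
    obtain ⟨F, hF⟩ := exists_continuousMap_stoneCech_extension u
    -- The regularized cost is bounded and continuous, hence extends to the compactification, and it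
    -- lies below c: this is membership in the cone with l = 1.
    have h1 : Λ F ≤ D := hΛ F D (mem_majorantCone.2 ⟨fun _ ↦ 0, fun _ ↦ 0, 1, .const 0, .const 0,
      fun x y ↦ by
        have h2 : F (e (x, y)) = u (x, y) := hF (x, y)
        rw [h2, hu, sub_zero, sub_zero, ENNReal.ofReal_toReal (hfin _), ENNReal.coe_one, one_mul]
        exact (lipschitzRegularization_le c n _).trans (min_le_left _ _), by simp⟩)
    rw [← hπint F] at h1
    simp only [hF, e] at h1
    calc ∫⁻ p, lipschitzRegularization c n p ∂π = ∫⁻ p, ENNReal.ofReal (u p) ∂π := by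
          simp only [hu, ENNReal.ofReal_toReal (hfin _)]
      _ = ENNReal.ofReal (∫ p, u p ∂π) :=
          (ofReal_integral_eq_lintegral_ofReal (u.integrable π)
            (ae_of_all _ fun p ↦ ENNReal.toReal_nonneg)).symm
      _ ≤ ENNReal.ofReal D := ENNReal.ofReal_le_ofReal h1

/-! ### Relative entropy of averaged conditional laws. -/

/-- A measure dominated by `M • μ` has relative entropy controlled by the exponential integrals of
bounded functions. -/
theorem klDiv_le_of_forall_integral_le {S : Type*} [MeasurableSpace S] {μ ν : Measure S}
    [IsProbabilityMeasure μ] [IsProbabilityMeasure ν] {M : ℝ≥0} (hνμ : ν ≤ M • μ) {C : ℝ}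
    (h : ∀ φ : S → ℝ, BoundedMeasurable φ →
      ∫ x, φ x ∂ν ≤ C + Real.log (∫ x, Real.exp (φ x) ∂μ)) :
    klDiv ν μ ≤ ENNReal.ofReal C := by
  have hac : ν ≪ μ :=
    (Measure.absolutelyContinuous_of_le hνμ).trans Measure.smul_absolutelyContinuous
  have hbound : ∀ᵐ x ∂μ, (ν.rnDeriv μ x) ≤ M := by
    refine ae_le_of_forall_setLIntegral_le_of_sigmaFinite (Measure.measurable_rnDeriv ν μ)
      fun s _ _ ↦ ?_
    rw [Measure.setLIntegral_rnDeriv hac, setLIntegral_const]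
    exact hνμ s
  have hbound' : ∀ᵐ x ∂μ, (ν.rnDeriv μ x).toReal ≤ M := by
    filter_upwards [hbound] with x hx
    exact ENNReal.toReal_mono ENNReal.coe_ne_top hx
  -- A version of the density bounded everywhere, not only almost everywhere, so that log(k + ε) is
  -- an admissible test function.
  set k : S → ℝ := fun x ↦ min (ν.rnDeriv μ x).toReal M with hk
  have hkmeas : Measurable k := by fun_prop
  have hk0 (x : S) : 0 ≤ k x := le_min ENNReal.toReal_nonneg M.2
  have hkM (x : S) : k x ≤ M := min_le_right _ _
  have hkae : k =ᵐ[μ] fun x ↦ (ν.rnDeriv μ x).toReal := by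
    filter_upwards [hbound'] with x hx
    exact min_eq_left hx
  have hkint : ∫ x, k x ∂μ = 1 := by
    rw [integral_congr_ae hkae, Measure.integral_toReal_rnDeriv hac, probReal_univ]
  have hkbm : BoundedMeasurable k := ⟨hkmeas, M, fun x ↦ by rw [abs_of_nonneg (hk0 x)]; exact hkM x⟩
  have hllr : Integrable (llr ν μ) ν := by
    rw [← integrable_rnDeriv_mul_log_iff hac]
    have hcont := Real.continuous_mul_log
    obtain ⟨B, hB⟩ := (isCompact_Icc (a := (0 : ℝ)) (b := M)).exists_bound_of_continuousOn
      hcont.continuousOn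
    refine Integrable.of_bound (by fun_prop) B ?_
    filter_upwards [hbound'] with x hx
    exact hB _ ⟨ENNReal.toReal_nonneg, hx⟩
  -- The optimal test function in the variational formula is the log-density; adding ε keeps it
  -- bounded below and changes the exponential integral only from 1 to 1 + ε.
  have key (ε : ℝ) (hε : 0 < ε) : ∫ x, llr ν μ x ∂ν ≤ C + ε := by
    have hφ : BoundedMeasurable fun x ↦ Real.log (k x + ε) := by
      refine ⟨by fun_prop, max |Real.log ε| |Real.log (M + ε)|, fun x ↦ ?_⟩
      exact abs_le_max_abs_abs (Real.log_le_log hε (by linarith [hk0 x]))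
        (Real.log_le_log (by linarith [hk0 x]) (by linarith [hkM x]))
    calc ∫ x, llr ν μ x ∂ν ≤ ∫ x, Real.log (k x + ε) ∂ν := by
          refine integral_mono_ae hllr (hφ.integrable ν) ?_
          filter_upwards [Measure.rnDeriv_pos hac, hac.ae_le hkae,
            hac.ae_le hbound] with x hx hxk hxM
          rw [llr, hxk]
          refine Real.log_le_log (ENNReal.toReal_pos hx.ne' (ne_top_of_le_ne_top (by simp) hxM)) ?_
          linarith
      _ ≤ C + Real.log (∫ x, Real.exp (Real.log (k x + ε)) ∂μ) := h _ hφ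
      _ = C + Real.log (1 + ε) := by
          have h1 (x : S) : Real.exp (Real.log (k x + ε)) = k x + ε :=
            Real.exp_log (by linarith [hk0 x])
          simp_rw [h1]
          rw [integral_add (hkbm.integrable μ) (integrable_const _), hkint]
          simp
      _ ≤ C + ε := by
          have := Real.log_le_sub_one_of_pos (show 0 < 1 + ε by linarith)
          linarith
  rw [← ENNReal.ofReal_toReal (klDiv_ne_top hac hllr),
    toReal_klDiv_of_measure_eq hac (by simp)]
  exact ENNReal.ofReal_le_ofReal (le_of_forall_pos_le_add key)

section Sampling

variable {Ω 𝓧 : Type*} [MeasurableSpace Ω] [MeasurableSpace 𝓧] {P : Measure Ω}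
  {X : ℕ → Ω → 𝓧} {μ : Measure 𝓧}

/-- The average over `k < n` of the conditional laws of `X k` given `A`. -/
noncomputable def averagedCondLaw (P : Measure Ω) (X : ℕ → Ω → 𝓧) (n : ℕ) (A : Set Ω) : Measure 𝓧 :=
  (n : ℝ≥0∞)⁻¹ • ∑ k ∈ Finset.range n, (P[|A]).map (X k)

theorem isProbabilityMeasure_averagedCondLaw [IsProbabilityMeasure P]
    (hX : ∀ k, Measurable (X k)) {n : ℕ} (hn : 0 < n)
    {A : Set Ω} (hPA : P A ≠ 0) : IsProbabilityMeasure (averagedCondLaw P X n A) := by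
  have := cond_isProbabilityMeasure hPA
  constructor
  simp only [averagedCondLaw, Measure.smul_apply, Measure.finsetSum_apply, smul_eq_mul,
    Measure.map_apply (hX _) MeasurableSet.univ, preimage_univ, measure_univ, Finset.sum_const,
    Finset.card_range, nsmul_eq_mul, mul_one]
  exact ENNReal.inv_mul_cancel (by simpa using hn.ne') (ENNReal.natCast_ne_top n)

theorem cond_le_smul (P : Measure Ω) (A : Set Ω) : P[|A] ≤ (P A)⁻¹ • P := by
  unfold ProbabilityTheory.cond
  gcongr
  exact Measure.restrict_le_self

theorem map_cond_le_smul (hX : ∀ k, Measurable (X k)) (hlaw : ∀ k, P.map (X k) = μ) (A : Set Ω)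
    (k : ℕ) : (P[|A]).map (X k) ≤ (P A)⁻¹ • μ := by
  rw [← hlaw k, ← Measure.map_smul]
  exact Measure.map_mono (cond_le_smul P A) (hX k)

theorem averagedCondLaw_le_smul (hX : ∀ k, Measurable (X k)) (hlaw : ∀ k, P.map (X k) = μ)
    {n : ℕ} (hn : 0 < n) (A : Set Ω) : averagedCondLaw P X n A ≤ (P A)⁻¹ • μ := by
  intro s
  simp only [averagedCondLaw, Measure.smul_apply, Measure.finsetSum_apply, smul_eq_mul]
  calc (n : ℝ≥0∞)⁻¹ * ∑ k ∈ Finset.range n, (P[|A]).map (X k) s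
      ≤ (n : ℝ≥0∞)⁻¹ * ∑ k ∈ Finset.range n, (P A)⁻¹ * μ s := by
        gcongr with k
        exact map_cond_le_smul hX hlaw A k s
    _ = (P A)⁻¹ * μ s := by
        rw [Finset.sum_const, Finset.card_range, nsmul_eq_mul, ← mul_assoc,
          ENNReal.inv_mul_cancel (by simpa using hn.ne') (ENNReal.natCast_ne_top n), one_mul]

theorem integral_averagedCondLaw (hX : ∀ k, Measurable (X k)) (hlaw : ∀ k, P.map (X k) = μ)
    (n : ℕ) {A : Set Ω} (hPA : P A ≠ 0) {f : 𝓧 → ℝ} (hf : Measurable f) (hfμ : Integrable f μ) :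
    ∫ x, f x ∂(averagedCondLaw P X n A) =
      (n : ℝ)⁻¹ * ∫ ω, ∑ k ∈ Finset.range n, f (X k ω) ∂(P[|A]) := by
  have hint (k : ℕ) : Integrable f ((P[|A]).map (X k)) :=
    (hfμ.smul_measure (ENNReal.inv_ne_top.2 hPA)).mono_measure (map_cond_le_smul hX hlaw A k)
  rw [averagedCondLaw, integral_smul_measure, integral_finsetSum_measure fun k _ ↦ hint k,
    integral_finsetSum (f := fun k ω ↦ f (X k ω)) _ fun k _ ↦ (integrable_map_measure
      hf.aestronglyMeasurable (hX k).aemeasurable).1 (hint k)]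
  simp only [integral_map (hX _).aemeasurable hf.aestronglyMeasurable, ENNReal.toReal_inv,
    ENNReal.toReal_natCast, smul_eq_mul]

/-- Jensen for exp under the conditional law, then enlarging the integral from `A` to the whole
space at the price of a factor 1/P(A), and independence to factor the exponential moment.
Measurability of `A` plays no part. -/
theorem integral_sum_cond_le_log [IsProbabilityMeasure P]
    (hX : ∀ k, Measurable (X k)) (hindep : iIndepFun X P)
    (hlaw : ∀ k, P.map (X k) = μ) (n : ℕ) {A : Set Ω} (hPA : P A ≠ 0)
    {φ : 𝓧 → ℝ} (hφ : BoundedMeasurable φ) :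
    ∫ ω, ∑ k ∈ Finset.range n, φ (X k ω) ∂(P[|A]) ≤
      -Real.log (P.real A) + n * Real.log (∫ x, Real.exp (φ x) ∂μ) := by
  have := cond_isProbabilityMeasure hPA
  have hμ : IsProbabilityMeasure μ := by
    rw [← hlaw 0]; exact Measure.isProbabilityMeasure_map (hX 0).aemeasurable
  obtain ⟨hφm, B, hB⟩ := id hφ
  have hPA' : 0 < P.real A := ENNReal.toReal_pos hPA (measure_ne_top _ _)
  set T : Ω → ℝ := fun ω ↦ ∑ k ∈ Finset.range n, φ (X k ω)
  have hTm : Measurable T := Finset.measurable_sum _ fun k _ ↦ hφm.comp (hX k)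
  have hT (ω : Ω) : |T ω| ≤ n * B := by
    refine (Finset.abs_sum_le_sum_abs _ _).trans ?_
    refine (Finset.sum_le_sum fun k _ ↦ hB (X k ω)).trans ?_
    simp
  have hTbm : BoundedMeasurable T := ⟨hTm, n * B, hT⟩
  have hexp : BoundedMeasurable fun ω ↦ Real.exp (T ω) :=
    ⟨hTm.exp, Real.exp (n * B), fun ω ↦ by
      rw [Real.abs_exp]
      exact Real.exp_le_exp.2 ((le_abs_self _).trans (hT ω))⟩
  have hexpφ : BoundedMeasurable fun x ↦ Real.exp (φ x) :=
    ⟨hφm.exp, Real.exp B, fun x ↦ by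
      rw [Real.abs_exp]
      exact Real.exp_le_exp.2 ((le_abs_self _).trans (hB x))⟩
  have hpos : 0 < ∫ x, Real.exp (φ x) ∂μ := integral_exp_pos (hexpφ.integrable μ)
  have hprod : ∫ ω, Real.exp (T ω) ∂P = (∫ x, Real.exp (φ x) ∂μ) ^ n := by
    have h1 := iIndepFun.mgf_sum (t := 1) (hindep.comp (fun _ ↦ φ) fun _ ↦ hφm)
      (fun k ↦ hφm.comp (hX k)) (Finset.range n)
    simp only [mgf, one_mul, Finset.sum_apply, Function.comp_apply] at h1
    rw [h1]
    have h2 (k : ℕ) : ∫ ω, Real.exp (φ (X k ω)) ∂P = ∫ x, Real.exp (φ x) ∂μ := by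
      rw [← hlaw k, integral_map (hX k).aemeasurable hφm.exp.aestronglyMeasurable]
    simp [h2]
  have hjensen : Real.exp (∫ ω, T ω ∂(P[|A])) ≤ ∫ ω, Real.exp (T ω) ∂(P[|A]) :=
    convexOn_exp.map_integral_le Real.continuous_exp.continuousOn isClosed_univ (by simp)
      (hTbm.integrable _) (hexp.integrable _)
  have hcond : ∫ ω, Real.exp (T ω) ∂(P[|A]) ≤
      (P.real A)⁻¹ * (∫ x, Real.exp (φ x) ∂μ) ^ n := by
    rw [ProbabilityTheory.cond, integral_smul_measure, ENNReal.toReal_inv, smul_eq_mul, ← hprod]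
    refine mul_le_mul_of_nonneg_left ?_ (by positivity)
    exact setIntegral_le_integral (hexp.integrable P) (ae_of_all _ fun ω ↦ (Real.exp_pos _).le)
  have hfin := Real.log_le_log (Real.exp_pos _) (hjensen.trans hcond)
  rwa [Real.log_exp, Real.log_mul (by positivity) (by positivity), Real.log_inv,
    Real.log_pow] at hfin

/-- Dividing the preceding bound by `n` gives exactly the variational inequality of
`klDiv_le_of_forall_integral_le`; the averaged law has density at most 1/P(A), as that lemma
requires. -/
theorem klDiv_averagedCondLaw_le [IsProbabilityMeasure P]
    (hX : ∀ k, Measurable (X k)) (hindep : iIndepFun X P)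
    (hlaw : ∀ k, P.map (X k) = μ) {n : ℕ} (hn : 0 < n) {A : Set Ω}
    (hPA : P A ≠ 0) :
    klDiv (averagedCondLaw P X n A) μ ≤ ENNReal.ofReal (-((n : ℝ)⁻¹ * Real.log (P.real A))) := by
  have := isProbabilityMeasure_averagedCondLaw hX hn hPA
  have hμ : IsProbabilityMeasure μ := by
    rw [← hlaw 0]; exact Measure.isProbabilityMeasure_map (hX 0).aemeasurable
  have hle := averagedCondLaw_le_smul hX hlaw hn A
  have hne : (P A)⁻¹ ≠ ⊤ := ENNReal.inv_ne_top.2 hPA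
  rw [← ENNReal.coe_toNNReal hne] at hle
  refine klDiv_le_of_forall_integral_le hle fun φ hφ ↦ ?_
  have hn' : (0 : ℝ) < n := by exact_mod_cast hn
  rw [integral_averagedCondLaw hX hlaw n hPA hφ.1 (hφ.integrable μ), inv_mul_le_iff₀ hn']
  refine (integral_sum_cond_le_log hX hindep hlaw n hPA hφ).trans (le_of_eq ?_)
  field_simp

end Sampling

/-! ### The large deviation lower bound by change of measure. -/

theorem pi_withDensity_eq {ι S : Type*} [Fintype ι] [MeasurableSpace S] (μ : Measure S)
    [IsProbabilityMeasure μ] {k : S → ℝ≥0∞} (hk : Measurable k)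
    [IsProbabilityMeasure (μ.withDensity k)] :
    Measure.pi (fun _ : ι ↦ μ.withDensity k) =
      (Measure.pi fun _ : ι ↦ μ).withDensity fun x ↦ ∏ i, k (x i) := by
  refine Measure.pi_eq fun s hs ↦ ?_
  rw [withDensity_apply _ (MeasurableSet.univ_pi hs),
    ← lintegral_indicator (MeasurableSet.univ_pi hs)]
  have h1 (x : ι → S) : (univ.pi s).indicator (fun x ↦ ∏ i, k (x i)) x =
      ∏ i, (s i).indicator k (x i) := by
    by_cases hx : x ∈ univ.pi s
    · rw [indicator_of_mem hx]
      exact Finset.prod_congr rfl fun i _ ↦ (indicator_of_mem (hx i (mem_univ i)) k).symm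
    · rw [indicator_of_notMem hx]
      obtain ⟨i, hi⟩ : ∃ i, x i ∉ s i := by simpa using hx
      exact (Finset.prod_eq_zero (Finset.mem_univ i) (indicator_of_notMem hi k)).symm
  simp_rw [h1]
  have hmeas (i : ι) : Measurable ((s i).indicator k) := hk.indicator (hs i)
  refine (lintegral_prod_eq_prod_lintegral_of_indepFun Finset.univ
    (fun i (x : ι → S) ↦ (s i).indicator k (x i))
    (iIndepFun_pi fun i ↦ (hmeas i).aemeasurable)
    fun i ↦ (hmeas i).comp (measurable_pi_apply i)).trans ?_
  refine Finset.prod_congr rfl fun i _ ↦ ?_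
  rw [withDensity_apply _ (hs i), ← lintegral_indicator (hs i),
    ← lintegral_map (hmeas i) (measurable_pi_apply i), (measurePreserving_eval _ i).map_eq]

theorem ae_tendsto_average_infinitePi {S : Type*} [MeasurableSpace S] (ν : Measure S)
    [IsProbabilityMeasure ν] {φ : S → ℝ} (hφ : Measurable φ) (hint : Integrable φ ν) :
    ∀ᵐ x ∂(Measure.infinitePi fun _ : ℕ ↦ ν),
      Tendsto (fun n : ℕ ↦ (∑ i ∈ Finset.range n, φ (x i)) / n) atTop (𝓝 (∫ s, φ s ∂ν)) := by
  have hmap (i : ℕ) : (Measure.infinitePi fun _ : ℕ ↦ ν).map (fun x ↦ x i) = ν :=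
    Measure.infinitePi_map_eval _ i
  have hm (i : ℕ) : Measurable fun x : ℕ → S ↦ x i := measurable_pi_apply i
  have hlaw := strong_law_ae_real (μ := Measure.infinitePi fun _ : ℕ ↦ ν) (fun i x ↦ φ (x i))
    (by
      refine (integrable_map_measure ?_ (hm 0).aemeasurable).1 ?_
      · exact hφ.aestronglyMeasurable
      · rwa [hmap])
    (fun i j hij ↦ (iIndepFun_infinitePi (P := fun _ : ℕ ↦ ν) (X := fun _ ↦ φ)
      fun _ ↦ hφ).indepFun hij)
    (fun i ↦ by
      have : IdentDistrib (fun x : ℕ → S ↦ x i) (fun x ↦ x 0) (Measure.infinitePi fun _ : ℕ ↦ ν)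
          (Measure.infinitePi fun _ : ℕ ↦ ν) :=
        ⟨(hm i).aemeasurable, (hm 0).aemeasurable, by rw [hmap, hmap]⟩
      exact this.comp hφ)
  have heq : ∫ x, φ (x 0) ∂(Measure.infinitePi fun _ : ℕ ↦ ν) = ∫ s, φ s ∂ν := by
    rw [← integral_map (f := φ) (hm 0).aemeasurable hφ.aestronglyMeasurable, hmap]
  simpa only [heq] using hlaw

/-- Change of measure on an event on which the log-likelihood ratio is controlled. -/
theorem infinitePi_le_exp_mul {S : Type*} [MeasurableSpace S] (μ : Measure S)
    [IsProbabilityMeasure μ] {k : S → ℝ} (hk : Measurable k) (hk0 : ∀ s, 0 ≤ k s)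
    [IsProbabilityMeasure (μ.withDensity fun s ↦ ENNReal.ofReal (k s))] (n : ℕ) (L a : ℝ)
    {f : S → ℝ} (hf : Measurable f) :
    Measure.infinitePi (fun _ : ℕ ↦ μ.withDensity fun s ↦ ENNReal.ofReal (k s))
      {x | a ≤ (∑ i ∈ Finset.range n, f (x i)) / n ∧
        ∑ i ∈ Finset.range n, Real.log (k (x i)) ≤ L} ≤
    ENNReal.ofReal (Real.exp L) * Measure.infinitePi (fun _ : ℕ ↦ μ)
      {x | a ≤ (∑ i ∈ Finset.range n, f (x i)) / n} := by
  set I := Finset.range n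
  have hrm : Measurable (I.restrict : (ℕ → S) → (I → S)) := Finset.measurable_restrict I
  set A : Set (I → S) := {y | a ≤ (∑ i, f (y i)) / n}
  set B : Set (I → S) := {y | ∑ i, Real.log (k (y i)) ≤ L}
  have hA : MeasurableSet A := measurableSet_le measurable_const (by fun_prop)
  have hB : MeasurableSet B := measurableSet_le (by fun_prop) measurable_const
  have hAB : {x : ℕ → S | a ≤ (∑ i ∈ I, f (x i)) / n ∧ ∑ i ∈ I, Real.log (k (x i)) ≤ L} =
      I.restrict ⁻¹' (A ∩ B) := by
    ext x
    simp only [mem_ofPred_eq, mem_preimage, mem_inter_iff, A, B, Finset.restrict,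
      Finset.sum_coe_sort I fun i ↦ f (x i), Finset.sum_coe_sort I fun i ↦ Real.log (k (x i))]
  have hA' : {x : ℕ → S | a ≤ (∑ i ∈ I, f (x i)) / n} = I.restrict ⁻¹' A := by
    ext x
    simp only [mem_ofPred_eq, mem_preimage, A, Finset.restrict,
      Finset.sum_coe_sort I fun i ↦ f (x i)]
  rw [hAB, hA', ← Measure.map_apply hrm (hA.inter hB), ← Measure.map_apply hrm hA,
    Measure.infinitePi_map_restrict, Measure.infinitePi_map_restrict,
    pi_withDensity_eq μ (by fun_prop), withDensity_apply _ (hA.inter hB)]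
  calc ∫⁻ y in A ∩ B, ∏ i, ENNReal.ofReal (k (y i)) ∂(Measure.pi fun _ : I ↦ μ)
      ≤ ∫⁻ y in A ∩ B, ENNReal.ofReal (Real.exp L) ∂(Measure.pi fun _ : I ↦ μ) := by
        refine setLIntegral_mono measurable_const fun y hy ↦ ?_
        rw [← ENNReal.ofReal_prod_of_nonneg fun i _ ↦ hk0 _]
        refine ENNReal.ofReal_le_ofReal ?_
        -- Only an inequality: where k vanishes, the convention log 0 = 0 makes the right-hand
        -- factor 1.
        calc ∏ i, k (y i) ≤ ∏ i, Real.exp (Real.log (k (y i))) :=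
              Finset.prod_le_prod (fun i _ ↦ hk0 _) fun i _ ↦ Real.le_exp_log _
          _ = Real.exp (∑ i, Real.log (k (y i))) := (Real.exp_sum _ _).symm
          _ ≤ Real.exp L := Real.exp_le_exp.2 hy.2
    _ ≤ ENNReal.ofReal (Real.exp L) * (Measure.pi fun _ : I ↦ μ) A := by
        rw [setLIntegral_const]
        gcongr
        exact inter_subset_left

/-- The large deviation lower bound for the empirical mean of `f`, by change of measure. -/
theorem eventually_exp_le_infinitePi {S : Type*} [MeasurableSpace S] {μ ν : Measure S}
    [IsProbabilityMeasure μ] [IsProbabilityMeasure ν] (hkl : klDiv ν μ ≠ ⊤) {f : S → ℝ}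
    (hf : Measurable f) (hfν : Integrable f ν) {a : ℝ} (ha : a < ∫ x, f x ∂ν) {δ : ℝ}
    (hδ : 0 < δ) :
    ∀ᶠ n : ℕ in atTop, ENNReal.ofReal (Real.exp (-(n * ((klDiv ν μ).toReal + δ)))) ≤
      Measure.infinitePi (fun _ : ℕ ↦ μ) {x | a ≤ (∑ i ∈ Finset.range n, f (x i)) / n} := by
  obtain ⟨hac, hllr⟩ := klDiv_ne_top_iff.1 hkl
  set K := (klDiv ν μ).toReal with hK
  have hKint : ∫ x, llr ν μ x ∂ν = K := (toReal_klDiv_of_measure_eq hac (by simp)).symm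
  set k : S → ℝ := fun x ↦ (ν.rnDeriv μ x).toReal
  have hk : Measurable k := by fun_prop
  have hdens : μ.withDensity (fun s ↦ ENNReal.ofReal (k s)) = ν := by
    refine Eq.trans (withDensity_congr_ae ?_) (Measure.withDensity_rnDeriv_eq ν μ hac)
    filter_upwards [Measure.rnDeriv_lt_top ν μ] with x hx
    exact ENNReal.ofReal_toReal hx.ne
  have : IsProbabilityMeasure (μ.withDensity fun s ↦ ENNReal.ofReal (k s)) := by
    rw [hdens]; infer_instance
  have hllrm : Measurable (llr ν μ) := measurable_llr ν μ
  -- By the strong law for f and for the log-likelihood ratio, these events have ν-probability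
  -- tending to 1. Half of δ is spent here; the other half absorbs the lower bound 1/2 on that
  -- probability.
  set E : ℕ → Set (ℕ → S) := fun n ↦ {x | a ≤ (∑ i ∈ Finset.range n, f (x i)) / n ∧
    ∑ i ∈ Finset.range n, Real.log (k (x i)) ≤ n * (K + δ / 2)}
  have hE (n : ℕ) : MeasurableSet (E n) := by
    refine MeasurableSet.inter (s₁ := {x : ℕ → S | a ≤ (∑ i ∈ Finset.range n, f (x i)) / n})
      (s₂ := {x : ℕ → S | ∑ i ∈ Finset.range n, Real.log (k (x i)) ≤ n * (K + δ / 2)}) ?_ ?_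
    · exact measurableSet_le measurable_const (by fun_prop)
    · exact measurableSet_le (by fun_prop) measurable_const
  have hlim : Tendsto (fun n ↦ Measure.infinitePi (fun _ : ℕ ↦ ν) (E n)) atTop (𝓝 1) := by
    rw [← measure_univ (μ := Measure.infinitePi fun _ : ℕ ↦ ν)]
    refine tendsto_measure_of_ae_tendsto_indicator_of_isFiniteMeasure atTop MeasurableSet.univ hE ?_
    filter_upwards [ae_tendsto_average_infinitePi ν hf hfν,
      ae_tendsto_average_infinitePi ν hllrm hllr] with x hx hx'
    rw [hKint] at hx'
    filter_upwards [hx.eventually_const_le ha,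
      hx'.eventually_le_const (show K < K + δ / 2 by linarith),
      eventually_gt_atTop 0] with n hn hn' hn0
    simp only [mem_univ, iff_true]
    refine ⟨hn, ?_⟩
    rw [div_le_iff₀ (by exact_mod_cast hn0), mul_comm] at hn'
    exact hn'
  have hhalf : ∀ᶠ n : ℕ in atTop, Real.exp (-(n * (δ / 2))) ≤ 1 / 2 := by
    have h1 : Tendsto (fun n : ℕ ↦ Real.exp (-(n * (δ / 2)))) atTop (𝓝 0) :=
      Real.tendsto_exp_neg_atTop_nhds_zero.comp
        (tendsto_natCast_atTop_atTop.atTop_mul_const (half_pos hδ))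
    exact h1.eventually_le_const (by norm_num)
  filter_upwards [hlim.eventually_const_le (show ENNReal.ofReal (1 / 2) < 1 by
    rw [ENNReal.ofReal_lt_one]; norm_num), hhalf] with n hn hn'
  have hle := infinitePi_le_exp_mul μ hk (fun _ ↦ ENNReal.toReal_nonneg) n (n * (K + δ / 2)) a hf
  rw [hdens] at hle
  calc ENNReal.ofReal (Real.exp (-(n * (K + δ))))
      ≤ ENNReal.ofReal (Real.exp (-(n * (K + δ / 2)))) * ENNReal.ofReal (1 / 2) := by
        rw [← ENNReal.ofReal_mul (Real.exp_pos _).le]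
        refine ENNReal.ofReal_le_ofReal ?_
        calc Real.exp (-(n * (K + δ)))
            = Real.exp (-(n * (K + δ / 2))) * Real.exp (-(n * (δ / 2))) := by
              rw [← Real.exp_add]; ring_nf
          _ ≤ _ := by gcongr
    _ ≤ ENNReal.ofReal (Real.exp (-(n * (K + δ / 2)))) *
        (ENNReal.ofReal (Real.exp (n * (K + δ / 2))) * Measure.infinitePi (fun _ : ℕ ↦ μ)
          {x | a ≤ (∑ i ∈ Finset.range n, f (x i)) / n}) := by
        gcongr
        exact hn.trans hle
    _ = _ := by
        rw [← mul_assoc, ← ENNReal.ofReal_mul (Real.exp_pos _).le, ← Real.exp_add]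
        simp

/-! ### From almost everywhere constraints to constraints off a null set. -/

theorem coe_le_coe_ennreal_iff {a : ℝ} {b : ℝ≥0∞} :
    (a : EReal) ≤ (b : EReal) ↔ ENNReal.ofReal a ≤ b := by
  rw [← EReal.coe_ennreal_le_coe_ennreal_iff, EReal.coe_ennreal_ofReal,
    EReal.coe_strictMono.monotone.map_max]
  simp [EReal.coe_ennreal_nonneg]

theorem coe_ennreal_le_neg_coe_iff {a : ℝ} (ha : a ≤ 0) {b : ℝ≥0∞} :
    (a : EReal) ≤ -(b : EReal) ↔ b ≤ ENNReal.ofReal (-a) := by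
  rw [EReal.le_neg, ← EReal.coe_ennreal_le_coe_ennreal_iff, EReal.coe_ennreal_ofReal,
    max_eq_left (by linarith), EReal.coe_neg]

/-- Off a null set, every point `y` is an essential limit point of `{q < f}` for all `q < f y`. -/
theorem exists_null_forall_measure_inter_ne_zero {S : Type*} [TopologicalSpace S]
    [SecondCountableTopology S] [MeasurableSpace S] (μ : Measure S) (f : S → ℝ) :
    ∃ N : Set S, μ N = 0 ∧ ∀ y ∉ N, ∀ q < f y, ∀ U ∈ 𝓝 y, μ (U ∩ {z | q < f z}) ≠ 0 := by
  set b := TopologicalSpace.countableBasis S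
  -- Rational levels and a countable basis leave only countably many null pieces to discard.
  let N : Set S := ⋃ q : ℚ, ⋃ V ∈ {V ∈ b | μ (V ∩ {z | (q : ℝ) < f z}) = 0}, V ∩ {z | (q : ℝ) < f z}
  refine ⟨N, ?_, fun y hy q hq U hU h0 ↦ hy ?_⟩
  · refine measure_iUnion_null fun q ↦ (measure_biUnion_null_iff
      ((TopologicalSpace.countable_countableBasis S).mono fun V hV ↦ hV.1)).2 fun V hV ↦ hV.2
  · obtain ⟨s, hqs, hs⟩ := exists_rat_btwn hq
    obtain ⟨V, hVb, hyV, hVU⟩ :=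
      (TopologicalSpace.isBasis_countableBasis S).mem_nhds_iff.1 hU
    refine mem_iUnion.2 ⟨s, mem_biUnion (x := V) ⟨hVb, measure_mono_null ?_ h0⟩ ⟨hyV, hs⟩⟩
    exact inter_subset_inter hVU fun z (hz : (s : ℝ) < f z) ↦ hqs.trans hz

/-- For an upper semicontinuous cost, an almost everywhere constraint holds off a null set. -/
theorem exists_null_forall_le_of_ae_prod {S : Type*} [TopologicalSpace S]
    [SecondCountableTopology S] [MeasurableSpace S] (μ : Measure S) [SFinite μ]
    {c : S × S → ℝ≥0∞} (hc : UpperSemicontinuous c) {f g : S → ℝ}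
    (h : ∀ᵐ p ∂(μ.prod μ), ((g p.1 + f p.2 : ℝ) : EReal) ≤ (c p : EReal)) :
    ∃ N : Set S, μ N = 0 ∧ ∀ x ∉ N, ∀ y ∉ N, ((g x + f y : ℝ) : EReal) ≤ (c (x, y) : EReal) := by
  obtain ⟨N, hN, hf⟩ := exists_null_forall_measure_inter_ne_zero μ f
  obtain ⟨N', hN', hg⟩ := exists_null_forall_measure_inter_ne_zero μ g
  refine ⟨N ∪ N', measure_union_null hN hN', fun x hx y hy ↦ ?_⟩
  rw [coe_le_coe_ennreal_iff]
  by_contra! hlt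
  set t := (c (x, y)).toReal with ht
  have hct : c (x, y) ≠ ⊤ := hlt.ne_top
  have htlt : t < g x + f y := by
    have := (ENNReal.lt_ofReal_iff_toReal_lt hct).1 hlt
    exact this
  -- With this margin, a violation at (x, y) persists on a product of two sets of positive measure:
  -- c stays below g(x) + f(y) - 2η near (x, y), while g > g(x) - η and f > f(y) - η there. This
  -- contradicts the almost everywhere constraint.
  set η := (g x + f y - t) / 4
  have hη : 0 < η := by simp only [η]; linarith
  have hsum : t < (g x - η) + (f y - η) := by simp only [η]; linarith
  have hnhds : {p | c p < ENNReal.ofReal ((g x - η) + (f y - η))} ∈ 𝓝 (x, y) :=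
    hc (x, y) _ ((ENNReal.lt_ofReal_iff_toReal_lt hct).2 hsum)
  obtain ⟨U, hU, V, hV, hUV⟩ := mem_nhds_prod_iff.1 hnhds
  have h1 := hg x (fun h ↦ hx (Or.inr h)) (g x - η) (by linarith) U hU
  have h2 := hf y (fun h ↦ hy (Or.inl h)) (f y - η) (by linarith) V hV
  refine mul_ne_zero h1 h2 ?_
  rw [← Measure.prod_prod]
  refine measure_mono_null (fun p hp ↦ ?_) (ae_iff.1 h)
  rw [mem_ofPred_eq, coe_le_coe_ennreal_iff, not_le]
  refine (show c p < _ from hUV (mk_mem_prod hp.1.1 hp.2.1)).trans_le (ENNReal.ofReal_le_ofReal ?_)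
  exact add_le_add hp.1.2.le hp.2.2.le

/-! ### The two implications. -/

section Transport

variable {𝓧 : Type*} [MeasurableSpace 𝓧] {μ ν : Measure 𝓧}

/-- The easy half of Kantorovich duality. -/
theorem ofReal_integral_add_le_transportCost {c : 𝓧 × 𝓧 → ℝ≥0∞} {f g : 𝓧 → ℝ}
    (hg : Integrable g μ) (hf : Integrable f ν) (hνμ : ν ≪ μ) {N : Set 𝓧} (hN : μ N = 0)
    (hle : ∀ x ∉ N, ∀ y ∉ N, ((g x + f y : ℝ) : EReal) ≤ (c (x, y) : EReal)) :
    ENNReal.ofReal (∫ x, g x ∂μ + ∫ y, f y ∂ν) ≤ transportCost c μ ν := by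
  refine le_iInf₂ fun π ⟨h1, h2⟩ ↦ ?_
  rw [Measure.fst] at h1
  rw [Measure.snd] at h2
  have hgπ : Integrable (fun p : 𝓧 × 𝓧 ↦ g p.1) π := by
    rw [← h1] at hg
    exact (integrable_map_measure hg.1 measurable_fst.aemeasurable).1 hg
  have hfπ : Integrable (fun p : 𝓧 × 𝓧 ↦ f p.2) π := by
    rw [← h2] at hf
    exact (integrable_map_measure hf.1 measurable_snd.aemeasurable).1 hf
  have hgeq : ∫ x, g x ∂μ = ∫ p, g p.1 ∂π := by
    rw [← h1] at hg ⊢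
    exact integral_map measurable_fst.aemeasurable hg.1
  have hfeq : ∫ y, f y ∂ν = ∫ p, f p.2 ∂π := by
    rw [← h2] at hf ⊢
    exact integral_map measurable_snd.aemeasurable hf.1
  have hN1 : ∀ᵐ p ∂π, p.1 ∉ N :=
    ae_of_ae_map measurable_fst.aemeasurable (h1 ▸ measure_eq_zero_iff_ae_notMem.1 hN)
  have hN2 : ∀ᵐ p ∂π, p.2 ∉ N :=
    ae_of_ae_map measurable_snd.aemeasurable (h2 ▸ measure_eq_zero_iff_ae_notMem.1 (hνμ hN))
  have hint := hgπ.add hfπ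
  calc ENNReal.ofReal (∫ x, g x ∂μ + ∫ y, f y ∂ν)
      = ENNReal.ofReal (∫ p, g p.1 + f p.2 ∂π) := by rw [hgeq, hfeq, integral_add hgπ hfπ]
    _ ≤ ENNReal.ofReal (∫ p, max (g p.1 + f p.2) 0 ∂π) :=
        ENNReal.ofReal_le_ofReal (integral_mono hint hint.pos_part fun p ↦ le_max_left _ _)
    _ = ∫⁻ p, ENNReal.ofReal (max (g p.1 + f p.2) 0) ∂π :=
        ofReal_integral_eq_lintegral_ofReal hint.pos_part (ae_of_all _ fun p ↦ le_max_right _ _)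
    _ ≤ ∫⁻ p, c p ∂π := by
        refine lintegral_mono_ae ?_
        filter_upwards [hN1, hN2] with p hp1 hp2
        rw [ENNReal.ofReal_max, ENNReal.ofReal_zero]
        exact max_le (coe_le_coe_ennreal_iff.1 (hle _ hp1 _ hp2)) zero_le

variable {Ω : Type*} [MeasurableSpace Ω] {P : Measure Ω}
  {X : ℕ → Ω → 𝓧} {α : ℝ≥0∞ → ℝ≥0∞} {c : 𝓧 × 𝓧 → ℝ≥0∞}

/-- The deviation bound implied by a transportation-cost inequality, for a measurable `f`. -/
theorem SatisfiesTCI.measure_average_le [IsProbabilityMeasure P]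
    (h : SatisfiesTCI α c μ) (hα : Monotone α)
    (hX : ∀ k, Measurable (X k)) (hindep : iIndepFun X P) (hlaw : ∀ k, P.map (X k) = μ)
    {f g : 𝓧 → ℝ} (hfm : Measurable f) (hf : Integrable f μ) (hg : Integrable g μ) {N : Set 𝓧}
    (hN : μ N = 0)
    (hle : ∀ x ∉ N, ∀ y ∉ N, ((g x + f y : ℝ) : EReal) ≤ (c (x, y) : EReal))
    {n : ℕ} (hn : 0 < n) (r : ℝ) :
    ((1 / (n : ℝ) : ℝ) : EReal) * ENNReal.log
      (P {ω | r ≤ (1 / (n : ℝ)) * (∑ k ∈ Finset.range n, f (X k ω)) + ∫ x, g x ∂μ}) ≤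
      -((α (ENNReal.ofReal r) : ℝ≥0∞) : EReal) := by
  set A := {ω | r ≤ (1 / (n : ℝ)) * (∑ k ∈ Finset.range n, f (X k ω)) + ∫ x, g x ∂μ}
  have hsm : Measurable fun ω ↦ ∑ k ∈ Finset.range n, f (X k ω) :=
    Finset.measurable_sum _ fun k _ ↦ hfm.comp (hX k)
  have hA : MeasurableSet A := measurableSet_le measurable_const
    ((hsm.const_mul _).add_const _)
  have hn' : (0 : ℝ) < n := by exact_mod_cast hn
  by_cases hPA : P A = 0
  · rw [hPA, ENNReal.log_zero, EReal.coe_mul_bot_of_pos (by positivity)]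
    exact bot_le
  have hQ := cond_isProbabilityMeasure hPA
  -- The competitor to which the transportation inequality is applied.
  set ν := averagedCondLaw P X n A
  have hν : IsProbabilityMeasure ν := isProbabilityMeasure_averagedCondLaw hX hn hPA
  have hνle : ν ≤ (P A)⁻¹ • μ := averagedCondLaw_le_smul hX hlaw hn A
  have hνμ : ν ≪ μ :=
    (Measure.absolutelyContinuous_of_le hνle).trans Measure.smul_absolutelyContinuous
  have hfν : Integrable f ν :=
    (hf.smul_measure (ENNReal.inv_ne_top.2 hPA)).mono_measure hνle
  have hfk (k : ℕ) : Integrable (fun ω ↦ f (X k ω)) (P[|A]) :=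
    (integrable_map_measure hfm.aestronglyMeasurable (hX k).aemeasurable).1
      ((hf.smul_measure (ENNReal.inv_ne_top.2 hPA)).mono_measure (map_cond_le_smul hX hlaw A k))
  have hmean : r - ∫ x, g x ∂μ ≤ ∫ y, f y ∂ν := by
    rw [integral_averagedCondLaw hX hlaw n hPA hfm hf, ← integral_const_mul]
    calc r - ∫ x, g x ∂μ = ∫ _, (r - ∫ x, g x ∂μ) ∂(P[|A]) := by simp
      _ ≤ _ := by
        refine integral_mono_ae (integrable_const _)
          ((integrable_finsetSum _ fun k _ ↦ hfk k).const_mul _) ?_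
        filter_upwards [ae_cond_mem hA] with ω hω
        have : r ≤ (1 / (n : ℝ)) * (∑ k ∈ Finset.range n, f (X k ω)) + ∫ x, g x ∂μ := hω
        rw [one_div] at this
        exact sub_le_iff_le_add.2 this
  have hcost : ENNReal.ofReal r ≤ transportCost c μ ν :=
    (ENNReal.ofReal_le_ofReal (by linarith)).trans
      (ofReal_integral_add_le_transportCost hg hfν hνμ hN hle)
  have hfinal : α (ENNReal.ofReal r) ≤ ENNReal.ofReal (-((n : ℝ)⁻¹ * Real.log (P.real A))) :=
    (hα hcost).trans ((h ν hν hνμ).trans (klDiv_averagedCondLaw_le hX hindep hlaw hn hPA))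
  rw [ENNReal.log_pos_real hPA (measure_ne_top _ _), ← EReal.coe_mul, one_div,
    coe_ennreal_le_neg_coe_iff]
  · exact hfinal
  · exact mul_nonpos_of_nonneg_of_nonpos (by positivity)
      (Real.log_nonpos ENNReal.toReal_nonneg measureReal_le_one)

theorem integral_empiricalMeasure [MeasurableSingletonClass 𝓧] (f : 𝓧 → ℝ) (n : ℕ) (x : ℕ → 𝓧) :
    ∫ y, f y ∂(empiricalMeasure n x) = (1 / (n : ℝ)) * ∑ k ∈ Finset.range n, f (x k) := by
  rw [empiricalMeasure, integral_smul_measure,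
    integral_finsetSum_measure fun k _ ↦ integrable_dirac (by simp)]
  simp [integral_dirac]

theorem SatisfiesTCI.deviationEstimate [IsProbabilityMeasure P] [MeasurableSingletonClass 𝓧]
    (h : SatisfiesTCI α c μ)
    (hα : Monotone α) (hX : ∀ k, Measurable (X k)) (hindep : iIndepFun X P)
    (hlaw : ∀ k, P.map (X k) = μ) {f g : 𝓧 → ℝ} (hf : Integrable f μ) (hg : Integrable g μ)
    (hle : ∃ N : Set 𝓧, μ N = 0 ∧
      ∀ x ∉ N, ∀ y ∉ N, ((g x + f y : ℝ) : EReal) ≤ (c (x, y) : EReal)) :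
    DeviationEstimate P X μ α f g := by
  obtain ⟨N, hN, hle⟩ := hle
  intro n hn r _
  refine ⟨by simp only [integral_empiricalMeasure], ?_⟩
  -- An integrable f is only almost everywhere measurable; a measurable version changes neither the
  -- probabilities nor, after enlarging `N`, the constraint.
  obtain ⟨f', hf'm, hff'⟩ := hf.1.aemeasurable
  have hX' : ∀ᵐ ω ∂P, ∀ k, f (X k ω) = f' (X k ω) := by
    refine ae_all_iff.2 fun k ↦ ?_
    rw [← hlaw k] at hff'
    exact ae_of_ae_map (hX k).aemeasurable hff'
  have hPeq : P {ω | r ≤ (1 / (n : ℝ)) * (∑ k ∈ Finset.range n, f (X k ω)) + ∫ x, g x ∂μ} =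
      P {ω | r ≤ (1 / (n : ℝ)) * (∑ k ∈ Finset.range n, f' (X k ω)) + ∫ x, g x ∂μ} := by
    refine measure_congr ?_
    filter_upwards [hX'] with ω hω
    refine propext ?_
    change (r ≤ _) ↔ (r ≤ _)
    simp only [hω]
  rw [hPeq]
  refine h.measure_average_le hα hX hindep hlaw hf'm (hf.congr hff') hg
    (N := N ∪ {y | f y ≠ f' y}) (measure_union_null hN (ae_iff.1 hff')) (fun x hx y hy ↦ ?_) hn r
  have hy' : f y = f' y := by by_contra hne; exact hy (Or.inr hne)
  rw [← hy']
  exact hle x (fun h ↦ hx (Or.inl h)) y fun h ↦ hy (Or.inl h)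

/-- A deviation estimate for `(f, g)` implies the transportation inequality tested on `(f, g)`. -/
theorem DeviationEstimate.le_klDiv [IsProbabilityMeasure μ] [IsProbabilityMeasure ν]
    (hX : ∀ k, Measurable (X k)) (hindep : iIndepFun X P) (hlaw : ∀ k, P.map (X k) = μ)
    {f g : 𝓧 → ℝ} (hfm : Measurable f) (hfν : Integrable f ν)
    (hdev : DeviationEstimate P X μ α f g) {r : ℝ} (hr : 0 < r)
    (hrlt : r < ∫ x, g x ∂μ + ∫ y, f y ∂ν) : α (ENNReal.ofReal r) ≤ klDiv ν μ := by
  by_cases hkl : klDiv ν μ = ⊤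
  · rw [hkl]; exact le_top
  -- For each δ a single large `n` suffices: the lower bound exp(-n(H + δ)) meets the assumed upper
  -- bound on the same probability.
  have key (δ : ℝ≥0) (hδ : 0 < δ) : α (ENNReal.ofReal r) ≤ klDiv ν μ + δ := by
    obtain ⟨n, hn, hn0⟩ := ((eventually_exp_le_infinitePi hkl hfm hfν
      (a := r - ∫ x, g x ∂μ) (by linarith) (NNReal.coe_pos.2 hδ)).and
        (eventually_gt_atTop 0)).exists
    have hn' : (0 : ℝ) < n := by exact_mod_cast hn0
    have hPeq : Measure.infinitePi (fun _ : ℕ ↦ μ)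
        {x | r - ∫ x, g x ∂μ ≤ (∑ i ∈ Finset.range n, f (x i)) / n} =
        P {ω | r ≤ (1 / (n : ℝ)) * (∑ k ∈ Finset.range n, f (X k ω)) + ∫ x, g x ∂μ} := by
      have hmap := iIndepFun.map_fun_eq_infinitePi_map hX hindep
      simp only [hlaw] at hmap
      rw [← hmap, Measure.map_apply (measurable_pi_lambda _ hX)
        (measurableSet_le measurable_const (by fun_prop))]
      congr 1
      ext ω
      simp only [preimage_ofPred_eq, mem_ofPred_eq, sub_le_iff_le_add, one_div_mul_eq_div]
    rw [hPeq] at hn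
    have h1 := (hdev n hn0 r hr).2
    have h2 := ENNReal.log_monotone hn
    rw [ENNReal.log_ofReal_of_pos (Real.exp_pos _), Real.log_exp] at h2
    have h3 : ((1 / (n : ℝ) : ℝ) : EReal) * ((-(n * ((klDiv ν μ).toReal + δ)) : ℝ) : EReal) ≤
        -((α (ENNReal.ofReal r) : ℝ≥0∞) : EReal) :=
      (mul_le_mul_of_nonneg_left h2 (EReal.coe_nonneg.2 (by positivity))).trans h1
    have h4 : (1 / (n : ℝ)) * (-(n * ((klDiv ν μ).toReal + δ))) = -((klDiv ν μ).toReal + δ) := by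
      field_simp
    have h5 : 0 ≤ (klDiv ν μ).toReal + δ := by positivity
    rw [← EReal.coe_mul, h4, coe_ennreal_le_neg_coe_iff (by linarith), neg_neg,
      ENNReal.ofReal_add ENNReal.toReal_nonneg δ.coe_nonneg, ENNReal.ofReal_toReal hkl,
      ENNReal.ofReal_coe_nnreal] at h3
    exact h3
  refine ENNReal.le_of_forall_pos_le_add fun δ hδ _ ↦ key δ hδ

end Transport

/-- Testing only bounded pairs whose constraint holds everywhere is enough, since duality needs no
others. Such pairs satisfy both the null-set and the almost everywhere form of the constraint, so
this one lemma serves both equivalences. -/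
theorem satisfiesTCI_of_forall_deviationEstimate {𝓧 Ω : Type*} [TopologicalSpace 𝓧] [PolishSpace 𝓧]
    [MeasurableSpace 𝓧] [BorelSpace 𝓧] [MeasurableSpace Ω] {μ : Measure 𝓧} [IsProbabilityMeasure μ]
    {P : Measure Ω} [IsProbabilityMeasure P] {X : ℕ → Ω → 𝓧} (hX : ∀ k, Measurable (X k))
    (hindep : iIndepFun X P) (hlaw : ∀ k, P.map (X k) = μ) {α : ℝ≥0∞ → ℝ≥0∞} (hα : Continuous α)
    (hα0 : α 0 = 0) {c : 𝓧 × 𝓧 → ℝ≥0∞} (hc : LowerSemicontinuous c)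
    (h : ∀ f g : 𝓧 → ℝ, BoundedMeasurable f → BoundedMeasurable g →
      (∀ x y, ((g x + f y : ℝ) : EReal) ≤ (c (x, y) : EReal)) → DeviationEstimate P X μ α f g) :
    SatisfiesTCI α c μ := by
  intro ν _ _
  by_contra! hlt
  have hW : transportCost c μ ν ≠ 0 := by
    intro h0
    rw [h0, hα0] at hlt
    exact not_lt_zero hlt
  -- Nonvanishing makes the left neighbourhood filter nontrivial. Approaching from below also yields
  -- a finite t when the cost is infinite.
  have : NeZero (transportCost c μ ν) := ⟨hW⟩
  have hlim : ∀ᶠ t in 𝓝[<] transportCost c μ ν, klDiv ν μ < α t :=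
    ((hα.tendsto _).eventually_const_lt hlt).filter_mono nhdsWithin_le_nhds
  obtain ⟨t, ht, htW⟩ := (hlim.and eventually_mem_nhdsWithin).exists
  lift t to ℝ≥0 using ne_top_of_lt htW
  have ht0 : 0 < t := by
    refine pos_iff_ne_zero.2 fun h0 ↦ ?_
    rw [h0, ENNReal.coe_zero, hα0] at ht
    exact not_lt_zero ht
  by_cases hdual : ∀ (g f : 𝓧 → ℝ), BoundedMeasurable g → BoundedMeasurable f →
      (∀ x y, ENNReal.ofReal (g x + f y) ≤ c (x, y)) → ∫ x, g x ∂μ + ∫ y, f y ∂ν ≤ t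
  · obtain ⟨π, h1, h2, h3⟩ := exists_coupling_lintegral_le μ ν hc hdual
    rw [ENNReal.ofReal_coe_nnreal] at h3
    have hπ : π ∈ couplings μ ν := ⟨h1, h2⟩
    have hle : transportCost c μ ν ≤ ∫⁻ p, c p ∂π := iInf₂_le π hπ
    exact absurd (hle.trans h3) (not_le.2 htW)
  · push Not at hdual
    obtain ⟨g, f, hg, hf, hle, hlt'⟩ := hdual
    have := (h f g hf hg fun x y ↦ coe_le_coe_ennreal_iff.2 (hle x y)).le_klDiv hX hindep hlaw hf.1
      (hf.integrable ν) (NNReal.coe_pos.2 ht0) hlt'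
    rw [ENNReal.ofReal_coe_nnreal] at this
    exact absurd this (not_le.2 ht)

theorem mainTheorem8 {𝓧 Ω : Type*} [TopologicalSpace 𝓧] [PolishSpace 𝓧] [MeasurableSpace 𝓧]
    [BorelSpace 𝓧] [MeasurableSpace Ω]
    (μ : Measure 𝓧) [IsProbabilityMeasure μ]
    (P : Measure Ω) [IsProbabilityMeasure P]
    (X : ℕ → Ω → 𝓧) (hX : ∀ k, Measurable (X k))
    (hindep : iIndepFun X P) (hlaw : ∀ k, P.map (X k) = μ)
    (α₁ α₂ : ℝ≥0∞ → ℝ≥0∞)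
    (hα₁_convex : ConvexOn ℝ≥0 Set.univ α₁) (hα₂_convex : ConvexOn ℝ≥0 Set.univ α₂)
    (hα₁_mono : Monotone α₁) (hα₂_mono : Monotone α₂)
    (hα₁_cont : Continuous α₁) (hα₂_cont : Continuous α₂)
    (hα₁_zero : α₁ 0 = 0) (hα₂_zero : α₂ 0 = 0)
    (c : 𝓧 × 𝓧 → ℝ≥0∞) (hc : LowerSemicontinuous c) :
    (SatisfiesTCI (fun t => min (α₁ t) (α₂ t)) c μ ↔
      ∀ f g : 𝓧 → ℝ, Integrable f μ → Integrable g μ →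
        (∃ N : Set 𝓧, μ N = 0 ∧ ∀ x ∉ N, ∀ y ∉ N, ((g x + f y : ℝ) : EReal) ≤ (c (x, y) : EReal)) →
        DeviationEstimate P X μ (fun t => min (α₁ t) (α₂ t)) f g) ∧
    (Continuous c →
      (SatisfiesTCI (fun t => min (α₁ t) (α₂ t)) c μ ↔
        ∀ f g : 𝓧 → ℝ, Integrable f μ → Integrable g μ →
          (∀ᵐ p ∂(μ.prod μ), ((g p.1 + f p.2 : ℝ) : EReal) ≤ (c p : EReal)) →
          DeviationEstimate P X μ (fun t => min (α₁ t) (α₂ t)) f g)) := by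
  have hmono : Monotone fun t => min (α₁ t) (α₂ t) := hα₁_mono.min hα₂_mono
  have hcont : Continuous fun t => min (α₁ t) (α₂ t) := hα₁_cont.min hα₂_cont
  have hzero : min (α₁ 0) (α₂ 0) = 0 := by rw [hα₁_zero, hα₂_zero, min_self]
  refine ⟨⟨fun h f g hf hg hle ↦ h.deviationEstimate hmono hX hindep hlaw hf hg hle, fun h ↦ ?_⟩,
    fun hcc ↦ ⟨fun h f g hf hg hle ↦ ?_, fun h ↦ ?_⟩⟩
  · exact satisfiesTCI_of_forall_deviationEstimate hX hindep hlaw hcont hzero hc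
      fun f g hf hg hle ↦ h f g (hf.integrable μ) (hg.integrable μ)
        ⟨∅, measure_empty, fun x _ y _ ↦ hle x y⟩
  · exact h.deviationEstimate hmono hX hindep hlaw hf hg
      (exists_null_forall_le_of_ae_prod μ hcc.upperSemicontinuous hle)
  · exact satisfiesTCI_of_forall_deviationEstimate hX hindep hlaw hcont hzero hc
      fun f g hf hg hle ↦ h f g (hf.integrable μ) (hg.integrable μ)
        (ae_of_all _ fun p ↦ hle p.1 p.2)
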